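/- Let $a,d,e\in\mathbb R$ be such that $P(x,y)=xy^2+ay-dx-e$ is irreducible in $\mathbb R[x,y]$, and let $C=\{(x,y)\in\mathbb R^2: P(x,y)=0\}$. Put $h_3(t)=\frac{-at+e}{t^2-d}\in\mathbb R(t)$ and, for $i\in\mathbb N_0$, let $$\mathcal S_{\le 3i}=\operatorname{span}_{\mathbb R}\bigl(\{h_3^i\}\cup\{h_3^j,\,h_3^jt: 1\le j\le i-1\}\cup\{1,t,\dots,t^i\}\bigr),$$ $$\mathcal T_{\le 3i}=\operatorname{span}_{\mathbb R}\bigl(\{h_3^it\}\cup\{h_3^j,\,h_3^jt: 1\le j\le i-1\}\cup\{1,t,\dots,t^i\}\bigr)$$ as subspaces of $\mathbb R(t)$. Let $\operatorname{Pos}(\mathcal S_{\le 3i})$ be the set of all $p\in\mathcal S_{\le 3i}$ with $p(t)\ge 0$ for every $t\in\mathbb R$ with $t^2\ne d$. (1) For every $k\in\mathbb N_0$ and every $p\in\operatorname{Pos}(\mathcal S_{\le 6k})$ there exist finitely many $f_i\in\mathcal S_{\le 3k}$ and $g_j\in\mathcal T_{\le 3k}$ such that $$p=\sum_i f_i^2+\sum_j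 g_j^2 .$$ (2) Let $\mathbb R[C]=\mathbb R[x,y]/I$, where $I$ is the ideal of all polynomials vanishing on $C$, let $\mathbb R[C]_{\le m}$ be the image of the polynomials of total degree at most $m$, let $Q(\mathbb R[C])$ be the total ring of fractions of $\mathbb R[C]$, and let $\widetilde C$ be the set of non-isolated points of $C$. For $k\ge 1$ put $$\mathcal B_k=\{x^k\}\cup\{x^j,\,x^jy:1\le j\le k-1\}\cup\{1,y,\dots,y^k\},\qquad \mathcal B_{V^{(k)}}=(\mathcal B_k\setminus\{x^k\})\cup\{x^ky\},$$ and let $V^{(k)}\subseteq Q(\mathbb R[C])$ be the span of $\mathcal B_{V^{(k)}}$. Then, for every $k\ge1$, $\mathcal B_k$ is a basis of $\mathbb R[C]_{\le k}$, $\mathcal B_{V^{(k)}}$ is a basis of $V^{(k)}$, $\dim_{\mathbb R}V^{(k)}=3k$, and for every $p\in\mathbb R[C]$ the following are equivalent: (a) $p\in\mathbb R[C]_{\le 2k}$ and $p(z)\ge 0$ for all $z\in\widetilde C$; (b) there exist finitely many $g_i\in\mathbb R[C]_{\le k}$ and $h_j\in V^{(k)}$ with $p=\sum_i g_i^2+\sum_j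 h_j^2$. -/

import Mathlib

noncomputable section

namespace RationalCubic

/-! ### Real plane curves and their coordinate rings -/

/-- The ring `ℝ[C] = ℝ[x,y] / I` of polynomial functions on `C ⊆ ℝ²`, where `I` is the ideal of
all polynomials vanishing on `C`. -/
abbrev CoordRing (C : Set (Fin 2 → ℝ)) : Type :=
  MvPolynomial (Fin 2) ℝ ⧸ MvPolynomial.vanishingIdeal ℝ C

/-- The total ring of fractions `Q(ℝ[C])`. -/
abbrev TotalFrac (C : Set (Fin 2 → ℝ)) : Type := FractionRing (CoordRing C)

/-- The restriction map `ℝ[x,y] → ℝ[C]`. -/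
def restrict (C : Set (Fin 2 → ℝ)) : MvPolynomial (Fin 2) ℝ →ₐ[ℝ] CoordRing C :=
  Ideal.Quotient.mkₐ ℝ (MvPolynomial.vanishingIdeal ℝ C)

/-- The value of an element of `ℝ[C]` at a point of `C`. -/
def evalAt (C : Set (Fin 2 → ℝ)) (z : C) : CoordRing C →ₐ[ℝ] ℝ :=
  Ideal.Quotient.liftₐ (MvPolynomial.vanishingIdeal ℝ C)
    (MvPolynomial.aeval (z : Fin 2 → ℝ)) (fun _ hp => hp z z.2)

/-- `ℝ[C]_{≤ m}`: the image of the polynomials of total degree at most `m`. -/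
def coordDegLE (C : Set (Fin 2 → ℝ)) (m : ℕ) : Submodule ℝ (CoordRing C) :=
  (MvPolynomial.restrictTotalDegree (Fin 2) ℝ m).map (restrict C).toLinearMap

/-- `Pos_m(D)` for `D ⊆ C`: the elements of `ℝ[C]_{≤ m}` that are nonnegative on `D`. -/
def PosOn (C D : Set (Fin 2 → ℝ)) (m : ℕ) : Set (CoordRing C) :=
  {p | p ∈ coordDegLE C m ∧ ∀ z : C, (z : Fin 2 → ℝ) ∈ D → 0 ≤ evalAt C z p}

/-- The set of non-isolated points of `C`. -/
def nonIsolated (C : Set (Fin 2 → ℝ)) : Set (Fin 2 → ℝ) :=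
  {z | z ∈ C ∧ AccPt z (Filter.principal C)}

/-- `(f, V)` is a certificate pair for `C`: for every `k ≥ 1` the space `V k ⊆ Q(ℝ[C])` has
dimension `3k`, and `p ∈ ℝ[C]` lies in `Pos_{2k}` of the set of non-isolated points of `C`
if and only if `p = ∑ gᵢ² + f ∑ hⱼ²` with finitely many `gᵢ ∈ ℝ[C]_{≤ k}` and `hⱼ ∈ V k`. -/
def IsCertificatePair (C : Set (Fin 2 → ℝ)) (f : TotalFrac C)
    (V : ℕ → Submodule ℝ (TotalFrac C)) : Prop :=
  ∀ k : ℕ, 1 ≤ k →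
    Module.finrank ℝ (V k) = 3 * k ∧
    ∀ p : CoordRing C,
      p ∈ PosOn C (nonIsolated C) (2 * k) ↔
        ∃ (m n : ℕ) (g : Fin m → CoordRing C) (h : Fin n → TotalFrac C),
          (∀ i, g i ∈ coordDegLE C k) ∧ (∀ j, h j ∈ V k) ∧
          algebraMap (CoordRing C) (TotalFrac C) p =
            ∑ i, (algebraMap (CoordRing C) (TotalFrac C) (g i)) ^ 2 + f * ∑ j, (h j) ^ 2

/-! ### The two families of monomials -/

/-- `{u^i} ∪ {u^j, u^j v : 1 ≤ j ≤ i - 1} ∪ {1, v, …, v^i}`. -/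
def basisS {A : Type*} [CommRing A] (u v : A) (i : ℕ) : Set A :=
  {u ^ i} ∪ {w | ∃ j, 1 ≤ j ∧ j < i ∧ (w = u ^ j ∨ w = u ^ j * v)} ∪ {w | ∃ l, l ≤ i ∧ w = v ^ l}

/-- `{u^i v} ∪ {u^j, u^j v : 1 ≤ j ≤ i - 1} ∪ {1, v, …, v^i}`. -/
def basisT {A : Type*} [CommRing A] (u v : A) (i : ℕ) : Set A :=
  {u ^ i * v} ∪ {w | ∃ j, 1 ≤ j ∧ j < i ∧ (w = u ^ j ∨ w = u ^ j * v)} ∪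
    {w | ∃ l, l ≤ i ∧ w = v ^ l}

/-! ### The spaces of rational functions in the parameter `t` -/

/-- The rational function `h₃ = (-a t + e) / (t² - d)` in `ℝ(t)`. -/
def h3 (a d e : ℝ) : RatFunc ℝ :=
  (-RatFunc.C a * RatFunc.X + RatFunc.C e) / (RatFunc.X ^ 2 - RatFunc.C d)

/-- The space `S_{≤ 3i}`. -/
def S (a d e : ℝ) (i : ℕ) : Submodule ℝ (RatFunc ℝ) :=
  Submodule.span ℝ (basisS (h3 a d e) RatFunc.X i)

/-- The space `T_{≤ 3i}`. -/
def T (a d e : ℝ) (i : ℕ) : Submodule ℝ (RatFunc ℝ) :=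
  Submodule.span ℝ (basisT (h3 a d e) RatFunc.X i)

/-- `Pos(S_{≤ 3i})`: the elements of `S_{≤ 3i}` that are nonnegative at every real `t` of the
domain of the parametrization, that is, at every real `t` with `t² ≠ d`. -/
def PosS (a d e : ℝ) (i : ℕ) : Set (RatFunc ℝ) :=
  {p | p ∈ S a d e i ∧ ∀ t : ℝ, t ^ 2 ≠ d → 0 ≤ RatFunc.eval (RingHom.id ℝ) t p}

/-! ### The cubic -/

/-- The polynomial `x y² + a y - d x - e`. -/
def cubic (a d e : ℝ) : MvPolynomial (Fin 2) ℝ :=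
  MvPolynomial.X 0 * MvPolynomial.X 1 ^ 2 + MvPolynomial.C a * MvPolynomial.X 1
    - MvPolynomial.C d * MvPolynomial.X 0 - MvPolynomial.C e

/-- The real zero set of the cubic. -/
def curve (a d e : ℝ) : Set (Fin 2 → ℝ) := {z | MvPolynomial.eval z (cubic a d e) = 0}

/-- The coordinate function `x` on the curve. -/
def xC (a d e : ℝ) : CoordRing (curve a d e) := restrict (curve a d e) (MvPolynomial.X 0)

/-- The coordinate function `y` on the curve. -/
def yC (a d e : ℝ) : CoordRing (curve a d e) := restrict (curve a d e) (MvPolynomial.X 1)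

/-- `B_k = {x^k, x^{k-1}, x^{k-1} y, …, x, x y, 1, y, …, y^k} ⊆ ℝ[C]`. -/
def basisB (a d e : ℝ) (k : ℕ) : Set (CoordRing (curve a d e)) :=
  basisS (xC a d e) (yC a d e) k

/-- `B_k` with `x^k` replaced by `x^k y`, as a subset of `Q(ℝ[C])`. -/
def basisV (a d e : ℝ) (k : ℕ) : Set (TotalFrac (curve a d e)) :=
  basisT (algebraMap _ (TotalFrac (curve a d e)) (xC a d e))
    (algebraMap _ (TotalFrac (curve a d e)) (yC a d e)) k

/-- The space `V^{(k)}`. -/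
def V (a d e : ℝ) (k : ℕ) : Submodule ℝ (TotalFrac (curve a d e)) :=
  Submodule.span ℝ (basisV a d e k)

end RationalCubic

end

open Polynomial

namespace RationalCubic

/-! ### Nonnegative real polynomials are sums of two squares -/

/-! Write N = e - a t, D = t² - d, so that h₃ = N / D. A common factor of N and D would divide the
cubic, so irreducibility makes them coprime (`isCoprime_of_irreducible_cubic`); only this
coprimality is used afterwards.

Over the denominator D^k, with k ≥ 1, both spaces become explicit: the numerators of elements of S
are c N^k + D q with c real and deg q ≤ 3k - 2, and those of T are c t N^k + D q (`mem_S_succ_iff`,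
`mem_T_succ_iff`). Both consist of polynomials of degree at most 3k, restricted only by one linear
condition on the residue modulo D divided by N^k: it is a constant for S and a multiple of t for T.

A nonnegative element of S with index 2k has a nonnegative numerator Q of degree at most 6k, hence Q
= F² + G² with F, G of degree at most 3k. Let f₀ + f₁ t and g₀ + g₁ t be the residues of F and G
divided by N^k. Since Q ≡ c N^(2k) modulo D, the t-coefficient of (f₀ + f₁ t)² + (g₀ + g₁ t)² modulo
D vanishes, that is, (f₀, g₀) ⊥ (f₁, g₁). One rotation of the pair (F, G) therefore kills the t-part
of the first residue and the constant part of the second, so the first square comes from S and the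
second from T (`exists_sq_add_sq_of_mem_PosS`). Conversely t² ≡ d modulo D, so squares from T return
to S.

For the curve, x ↦ h₃, y ↦ t embeds the coordinate ring and its fraction ring into ℝ(t), carrying
the degree filtration to S and V to T. Coprimality excludes points with y² = d, so C is exactly the
parametrized set and has no isolated points. -/

lemma eval_nonneg_of_finite_compl {p : ℝ[X]} {s : Set ℝ} (hs : s.Finite)
    (h : ∀ t ∉ s, 0 ≤ p.eval t) (t : ℝ) : 0 ≤ p.eval t := by
  have hd : Dense sᶜ := hs.countable.dense_compl ℝ
  have hc : IsClosed {t : ℝ | 0 ≤ p.eval t} := isClosed_le continuous_const p.continuous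
  exact hc.closure_subset_iff.2 (fun x hx => h x hx) (hd t)

lemma eval_nonneg_of_mul {p q : ℝ[X]} (hp : p ≠ 0) (h0 : ∀ t, 0 ≤ p.eval t)
    (h : ∀ t, 0 ≤ (p * q).eval t) (t : ℝ) : 0 ≤ q.eval t := by
  refine eval_nonneg_of_finite_compl (s := {t | p.IsRoot t}) (p.finite_setOfPred_isRoot hp) ?_ t
  intro t ht
  have h1 := h t
  rw [eval_mul] at h1
  exact nonneg_of_mul_nonneg_right h1 (lt_of_le_of_ne (h0 t) (Ne.symm ht))

/-- A root of a nonnegative polynomial is a minimum, so the derivative vanishes there; for (X - x) q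
that derivative at x is q(x). -/
lemma sq_dvd_of_nonneg_of_isRoot {p : ℝ[X]} (h : ∀ t, 0 ≤ p.eval t) {x : ℝ} (hx : p.IsRoot x) :
    (X - C x) ^ 2 ∣ p := by
  obtain ⟨q, rfl⟩ := dvd_iff_isRoot.2 hx
  rw [pow_two]
  refine mul_dvd_mul_left _ (dvd_iff_isRoot.2 ?_)
  have hmin : IsLocalMin (fun t => ((X - C x) * q).eval t) x :=
    Filter.Eventually.of_forall fun t => by simpa using h t
  have h0 := hmin.hasDerivAt_eq_zero (((X - C x) * q).hasDerivAt x)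
  simpa [IsRoot.def] using h0

/-- Induction on the degree: a complex root provides a quadratic factor that is itself a sum of two
squares, and such sums are closed under products. The degree bounds are what later keeps the
summands inside S and T. -/
theorem exists_two_squares_of_nonneg (p : ℝ[X]) (h : ∀ t, 0 ≤ p.eval t) :
    ∃ f g : ℝ[X], p = f ^ 2 + g ^ 2 ∧ 2 * f.natDegree ≤ p.natDegree ∧
      2 * g.natDegree ≤ p.natDegree := by
  induction hn : p.natDegree using Nat.strong_induction_on generalizing p with
  | _ n ih =>
  subst hn
  by_cases h0 : p.natDegree = 0
  · obtain ⟨c, rfl⟩ := natDegree_eq_zero.1 h0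
    have hc : 0 ≤ c := by simpa using h 0
    refine ⟨C √c, 0, ?_, by simp, by simp⟩
    rw [← C_pow, Real.sq_sqrt hc]; simp
  have step : ∀ u v q : ℝ[X], p = (u ^ 2 + v ^ 2) * q → (u ^ 2 + v ^ 2).natDegree = 2 →
      u.natDegree ≤ 1 → v.natDegree ≤ 1 →
      ∃ f g : ℝ[X], p = f ^ 2 + g ^ 2 ∧ 2 * f.natDegree ≤ p.natDegree ∧
        2 * g.natDegree ≤ p.natDegree := by
    intro u v q hp h2 hu hv
    have hw : u ^ 2 + v ^ 2 ≠ 0 := by rintro h; simp [h] at h2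
    have hq : q ≠ 0 := by rintro rfl; simp [hp] at h0
    have hdeg : p.natDegree = 2 + q.natDegree := by rw [hp, natDegree_mul hw hq, h2]
    have hqn : ∀ t, 0 ≤ q.eval t :=
      eval_nonneg_of_mul hw (fun t => by simp; positivity) (by rwa [← hp])
    obtain ⟨f, g, hfg, hf, hg⟩ := ih q.natDegree (by omega) q hqn rfl
    have aux : ∀ a b : ℝ[X], a.natDegree ≤ 1 → 2 * b.natDegree ≤ q.natDegree →
        (a * b).natDegree ≤ p.natDegree / 2 := fun a b ha hb => by
      have := natDegree_mul_le (p := a) (q := b)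
      omega
    -- The product identity for sums of two squares, read off from (u + iv)(f + ig).
    refine ⟨u * f - v * g, u * g + v * f, by rw [hp, hfg]; ring, ?_, ?_⟩
    · have := natDegree_sub_le_of_le (aux u f hu hf) (aux v g hv hg)
      simp only [max_self] at this
      omega
    · have := natDegree_add_le_of_le (aux u g hu hg) (aux v f hv hf)
      simp only [max_self] at this
      omega
  obtain ⟨z, hz⟩ := IsAlgClosed.exists_aeval_eq_zero ℂ p
    (fun h => h0 (natDegree_eq_zero_iff_degree_le_zero.2 h.le))
  by_cases him : z.im = 0
  · have hre : p.IsRoot z.re := by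
      have : z = algebraMap ℝ ℂ z.re := Complex.ext (by simp) (by simp [him])
      rw [this, aeval_algebraMap_apply_eq_algebraMap_eval] at hz
      simpa using hz
    obtain ⟨q, hq⟩ := sq_dvd_of_nonneg_of_isRoot h hre
    refine step (X - C z.re) 0 q (by rw [hq]; ring) ?_ (by simp) (by simp)
    simp
  · obtain ⟨q, hq⟩ := p.quadratic_dvd_of_aeval_eq_zero_im_ne_zero hz him
    have hsq : (X - C z.re) ^ 2 + (C z.im) ^ 2 = X ^ 2 - C (2 * z.re) * X + C (‖z‖ ^ 2) := by
      rw [← Complex.normSq_eq_norm_sq, Complex.normSq_apply]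
      simp only [C_mul, C_add]
      rw [show (C (2 : ℝ) : ℝ[X]) = 2 from rfl]
      ring
    refine step (X - C z.re) (C z.im) q (by rw [hsq, hq]) ?_ (by simp) (by simp)
    have : ((X - C z.re) ^ 2 : ℝ[X]).natDegree = 2 := by simp
    rw [← C_pow, natDegree_add_C, this]

/-! ### Numerator and denominator of the parametrization -/

/-- The numerator `-a t + e` of `h₃`. -/
noncomputable def numPoly (a e : ℝ) : ℝ[X] := -C a * X + C e

/-- The denominator `t² - d` of `h₃`. -/
noncomputable def denPoly (d : ℝ) : ℝ[X] := X ^ 2 - C d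

lemma natDegree_numPoly_le (a e : ℝ) : (numPoly a e).natDegree ≤ 1 := by
  unfold numPoly
  compute_degree

lemma monic_denPoly (d : ℝ) : (denPoly d).Monic := monic_X_pow_sub_C d two_ne_zero

lemma denPoly_ne_zero (d : ℝ) : denPoly d ≠ 0 := (monic_denPoly d).ne_zero

lemma natDegree_denPoly (d : ℝ) : (denPoly d).natDegree = 2 := natDegree_X_pow_sub_C

@[simp] lemma eval_numPoly (a e t : ℝ) : (numPoly a e).eval t = -a * t + e := by simp [numPoly]

@[simp] lemma eval_denPoly (d t : ℝ) : (denPoly d).eval t = t ^ 2 - d := by simp [denPoly]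

lemma algebraMap_denPoly_ne_zero (d : ℝ) : algebraMap ℝ[X] (RatFunc ℝ) (denPoly d) ≠ 0 := by
  simpa using denPoly_ne_zero d

lemma h3_eq_div (a d e : ℝ) :
    h3 a d e = algebraMap ℝ[X] (RatFunc ℝ) (numPoly a e) / algebraMap _ _ (denPoly d) := by
  simp [h3, numPoly, denPoly]

lemma h3_mul_den (a d e : ℝ) :
    h3 a d e * algebraMap ℝ[X] (RatFunc ℝ) (denPoly d) = algebraMap _ _ (numPoly a e) := by
  rw [h3_eq_div, div_mul_cancel₀ _ (algebraMap_denPoly_ne_zero d)]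

lemma h3_pow_mul_den_pow (a d e : ℝ) (j : ℕ) :
    h3 a d e ^ j * algebraMap ℝ[X] (RatFunc ℝ) (denPoly d) ^ j =
      algebraMap _ _ (numPoly a e ^ j) := by
  rw [← mul_pow, h3_mul_den, map_pow]

/-- Reduction modulo `t² - d`, normalised by a power of the numerator. -/
lemma exists_eq_linear_mul_add_den_mul {a d e : ℝ} (hco : IsCoprime (numPoly a e) (denPoly d))
    (j : ℕ) (q : ℝ[X]) :
    ∃ (α β : ℝ) (r : ℝ[X]), q = (C α + C β * X) * numPoly a e ^ j + denPoly d * r := by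
  obtain ⟨u, v, huv⟩ := hco.pow_left (m := j)
  have hmod := modByMonic_add_div (q * u) (denPoly d)
  have hdeg : ((q * u) %ₘ denPoly d).natDegree ≤ 1 := by
    have := natDegree_modByMonic_lt (q * u) (monic_denPoly d)
      (fun h => by simpa [h] using natDegree_denPoly d)
    rw [natDegree_denPoly] at this
    omega
  obtain ⟨β, α, h1⟩ := exists_eq_X_add_C_of_natDegree_le_one hdeg
  refine ⟨α, β, ((q * u) /ₘ denPoly d) * numPoly a e ^ j + q * v, ?_⟩
  rw [h1] at hmod
  linear_combination (-q) * huv - (numPoly a e ^ j) * hmod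

lemma natDegree_of_den_mul_add {d : ℝ} {p q r : ℝ[X]} {m : ℕ} (h : q = p + denPoly d * r)
    (hq : q.natDegree ≤ m + 2) (hp : p.natDegree ≤ m + 2) : r.natDegree ≤ m := by
  by_cases hr : r = 0
  · simp [hr]
  have h1 : denPoly d * r = q - p := by rw [h]; ring
  have h2 := natDegree_sub_le_of_le hq hp
  rw [← h1, natDegree_mul (denPoly_ne_zero d) hr, natDegree_denPoly, max_self] at h2
  omega

lemma natDegree_linear_mul_pow_le (a e α β : ℝ) (j : ℕ) :
    ((C α + C β * X) * numPoly a e ^ j).natDegree ≤ 1 + j := by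
  have h1 : (C α + C β * X : ℝ[X]).natDegree ≤ 1 := by compute_degree
  have h2 := natDegree_pow_le_of_le j (natDegree_numPoly_le a e)
  simpa using natDegree_mul_le_of_le h1 h2

/-! ### The spaces `S` and `T` in terms of numerators -/

/-- `{u^j, u^j v : 1 ≤ j ≤ i - 1} ∪ {1, v, …, v^i}`. -/
def basisCommon {A : Type*} [CommRing A] (u v : A) (i : ℕ) : Set A :=
  {w | ∃ j, 1 ≤ j ∧ j < i ∧ (w = u ^ j ∨ w = u ^ j * v)} ∪ {w | ∃ l, l ≤ i ∧ w = v ^ l}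

lemma basisS_eq_insert {A : Type*} [CommRing A] (u v : A) (i : ℕ) :
    basisS u v i = insert (u ^ i * 1) (basisCommon u v i) := by
  rw [basisS, basisCommon, Set.union_assoc, Set.singleton_union, mul_one]

lemma basisT_eq_insert {A : Type*} [CommRing A] (u v : A) (i : ℕ) :
    basisT u v i = insert (u ^ i * v) (basisCommon u v i) := by
  rw [basisT, basisCommon, Set.union_assoc, Set.singleton_union]

lemma algebraMap_mem_span_basisCommon (u : RatFunc ℝ) {i : ℕ} {q : ℝ[X]} (hq : q.natDegree ≤ i) :
    algebraMap ℝ[X] (RatFunc ℝ) q ∈ Submodule.span ℝ (basisCommon u RatFunc.X i) := by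
  rw [as_sum_range_C_mul_X_pow q, map_sum]
  refine Submodule.sum_mem _ fun l hl => ?_
  have : algebraMap ℝ[X] (RatFunc ℝ) (C (q.coeff l) * X ^ l) = q.coeff l • RatFunc.X ^ l := by
    simp [RatFunc.smul_eq_C_mul]
  rw [this]
  refine Submodule.smul_mem _ _ (Submodule.subset_span (Or.inr ⟨l, ?_, rfl⟩))
  have := Finset.mem_range.1 hl
  omega

/-- Induction on the exponent of the denominator: modulo D the numerator is (α + β t) N^(j+1), so
subtracting α h₃^(j+1) + β h₃^(j+1) t lowers that exponent by one. What remains at the end is a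
polynomial of degree at most i. -/
lemma mem_span_basisCommon_of_mul_den_pow {a d e : ℝ}
    (hco : IsCoprime (numPoly a e) (denPoly d)) {i : ℕ} (j : ℕ) (hj : j < i) (r : RatFunc ℝ)
    (q : ℝ[X]) (hq : q.natDegree ≤ i + 2 * j)
    (hr : r * algebraMap ℝ[X] (RatFunc ℝ) (denPoly d) ^ j = algebraMap _ _ q) :
    r ∈ Submodule.span ℝ (basisCommon (h3 a d e) RatFunc.X i) := by
  induction j generalizing r q with
  | zero =>
    rw [pow_zero, mul_one] at hr
    rw [hr]
    exact algebraMap_mem_span_basisCommon _ hq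
  | succ j ih =>
    obtain ⟨α, β, s, hs⟩ := exists_eq_linear_mul_add_den_mul hco (j + 1) q
    have hs' : s.natDegree ≤ i + 2 * j :=
      natDegree_of_den_mul_add hs hq ((natDegree_linear_mul_pow_le a e α β (j + 1)).trans (by omega))
    have hD := algebraMap_denPoly_ne_zero d
    set h := h3 a d e with hh
    have key := ih (by omega) (r - α • h ^ (j + 1) - β • (h ^ (j + 1) * RatFunc.X)) s hs' (by
      have h1 := h3_pow_mul_den_pow a d e (j + 1)
      rw [← hh] at h1
      apply mul_right_cancel₀ hD
      rw [hs] at hr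
      simp only [map_add, map_mul, RatFunc.algebraMap_C, RatFunc.algebraMap_X] at hr
      rw [RatFunc.smul_eq_C_mul, RatFunc.smul_eq_C_mul]
      linear_combination hr - (RatFunc.C α + RatFunc.C β * RatFunc.X) * h1)
    have e1 : h ^ (j + 1) ∈ Submodule.span ℝ (basisCommon h RatFunc.X i) :=
      Submodule.subset_span (Or.inl ⟨j + 1, by omega, hj, Or.inl rfl⟩)
    have e2 : h ^ (j + 1) * RatFunc.X ∈ Submodule.span ℝ (basisCommon h RatFunc.X i) :=
      Submodule.subset_span (Or.inl ⟨j + 1, by omega, hj, Or.inr rfl⟩)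
    have := add_mem (add_mem key (Submodule.smul_mem _ β e2)) (Submodule.smul_mem _ α e1)
    simpa using this

/-- The monomial `h₃^m t^l` written over the denominator `(t² - d)^n`. -/
lemma h3_pow_mul_X_pow_mul_den_pow (a d e : ℝ) {m n : ℕ} (hmn : m ≤ n) (l : ℕ) :
    h3 a d e ^ m * RatFunc.X ^ l * algebraMap ℝ[X] (RatFunc ℝ) (denPoly d) ^ n =
      algebraMap _ _ (numPoly a e ^ m * X ^ l * denPoly d ^ (n - m)) := by
  obtain ⟨k, rfl⟩ := Nat.exists_eq_add_of_le hmn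
  have h1 := h3_pow_mul_den_pow a d e m
  simp only [Nat.add_sub_cancel_left, map_mul, map_pow, RatFunc.algebraMap_X] at h1 ⊢
  rw [pow_add]
  linear_combination (RatFunc.X ^ l * algebraMap ℝ[X] (RatFunc ℝ) (denPoly d) ^ k) * h1

lemma natDegree_num_mul_X_mul_den_le (a d e : ℝ) {m n : ℕ} (hmn : m ≤ n) (l : ℕ) :
    (numPoly a e ^ m * X ^ l * denPoly d ^ (n - m)).natDegree + m ≤ 2 * n + l := by
  have h1 := natDegree_pow_le_of_le m (natDegree_numPoly_le a e)
  have h2 : (X ^ l : ℝ[X]).natDegree ≤ l := natDegree_X_pow_le l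
  have h3 := natDegree_pow_le_of_le (n - m) (natDegree_denPoly d).le
  have := natDegree_mul_le_of_le (natDegree_mul_le_of_le h1 h2) h3
  omega

theorem mem_span_basisCommon_iff {a d e : ℝ} (hco : IsCoprime (numPoly a e) (denPoly d)) (n : ℕ)
    (r : RatFunc ℝ) :
    r ∈ Submodule.span ℝ (basisCommon (h3 a d e) RatFunc.X (n + 1)) ↔
      ∃ q : ℝ[X], q.natDegree ≤ 3 * n + 1 ∧
        r * algebraMap ℝ[X] (RatFunc ℝ) (denPoly d) ^ n = algebraMap _ _ q := by
  constructor
  · intro hr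
    have mono : ∀ m l, m ≤ n → l ≤ m + n + 1 → ∃ q : ℝ[X], q.natDegree ≤ 3 * n + 1 ∧
        h3 a d e ^ m * RatFunc.X ^ l * algebraMap ℝ[X] (RatFunc ℝ) (denPoly d) ^ n =
          algebraMap _ _ q := fun m l hm hl =>
      ⟨_, by have := natDegree_num_mul_X_mul_den_le a d e hm l; omega,
        h3_pow_mul_X_pow_mul_den_pow a d e hm l⟩
    induction hr using Submodule.span_induction with
    | mem x hx =>
      rcases hx with ⟨j, h1, h2, rfl | rfl⟩ | ⟨l, hl, rfl⟩
      · simpa using mono j 0 (by omega) (by omega)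
      · simpa using mono j 1 (by omega) (by omega)
      · simpa using mono 0 l (by omega) (by omega)
    | zero => exact ⟨0, by simp, by simp⟩
    | add x y _ _ hx hy =>
      obtain ⟨p, hp, hp'⟩ := hx
      obtain ⟨q, hq, hq'⟩ := hy
      exact ⟨p + q, by simpa using natDegree_add_le_of_le hp hq, by rw [add_mul, hp', hq', map_add]⟩
    | smul c x _ hx =>
      obtain ⟨p, hp, hp'⟩ := hx
      exact ⟨c • p, (natDegree_smul_le c p).trans hp, by
        rw [smul_mul_assoc, hp', smul_eq_C_mul, map_mul, RatFunc.algebraMap_C,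
          RatFunc.smul_eq_C_mul]⟩
  · rintro ⟨q, hq, hr⟩
    exact mem_span_basisCommon_of_mul_den_pow hco n (by omega) r q (by omega) hr

/-- The polynomial w lets S (w = 1) and T (w = X) be treated together. -/
theorem mem_span_insert_basisCommon_iff {a d e : ℝ} (hco : IsCoprime (numPoly a e) (denPoly d))
    (n : ℕ) (w : ℝ[X]) (r : RatFunc ℝ) :
    r ∈ Submodule.span ℝ (insert (h3 a d e ^ (n + 1) * algebraMap ℝ[X] (RatFunc ℝ) w)
        (basisCommon (h3 a d e) RatFunc.X (n + 1))) ↔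
      ∃ (c : ℝ) (q : ℝ[X]), q.natDegree ≤ 3 * n + 1 ∧
        r * algebraMap ℝ[X] (RatFunc ℝ) (denPoly d) ^ (n + 1) =
          algebraMap _ _ (C c * w * numPoly a e ^ (n + 1) + denPoly d * q) := by
  have h1 := h3_pow_mul_den_pow a d e (n + 1)
  have hD := algebraMap_denPoly_ne_zero d
  rw [Submodule.mem_span_insert]
  constructor
  · rintro ⟨c, z, hz, rfl⟩
    obtain ⟨q, hq, hzq⟩ := (mem_span_basisCommon_iff hco n z).1 hz
    refine ⟨c, q, hq, ?_⟩
    simp only [map_add, map_mul, RatFunc.algebraMap_C, RatFunc.smul_eq_C_mul]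
    linear_combination (RatFunc.C c * algebraMap ℝ[X] (RatFunc ℝ) w) * h1 +
      algebraMap ℝ[X] (RatFunc ℝ) (denPoly d) * hzq
  · rintro ⟨c, q, hq, hr⟩
    refine ⟨c, r - c • (h3 a d e ^ (n + 1) * algebraMap ℝ[X] (RatFunc ℝ) w),
      (mem_span_basisCommon_iff hco n _).2 ⟨q, hq, mul_right_cancel₀ hD ?_⟩, by abel⟩
    simp only [map_add, map_mul, RatFunc.algebraMap_C] at hr
    rw [RatFunc.smul_eq_C_mul]
    linear_combination hr - (RatFunc.C c * algebraMap ℝ[X] (RatFunc ℝ) w) * h1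

theorem mem_S_succ_iff {a d e : ℝ} (hco : IsCoprime (numPoly a e) (denPoly d)) (n : ℕ)
    (r : RatFunc ℝ) :
    r ∈ S a d e (n + 1) ↔ ∃ (c : ℝ) (q : ℝ[X]), q.natDegree ≤ 3 * n + 1 ∧
      r * algebraMap ℝ[X] (RatFunc ℝ) (denPoly d) ^ (n + 1) =
        algebraMap _ _ (C c * numPoly a e ^ (n + 1) + denPoly d * q) := by
  simpa [S, basisS_eq_insert] using mem_span_insert_basisCommon_iff hco n 1 r

theorem mem_T_succ_iff {a d e : ℝ} (hco : IsCoprime (numPoly a e) (denPoly d)) (n : ℕ)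
    (r : RatFunc ℝ) :
    r ∈ T a d e (n + 1) ↔ ∃ (c : ℝ) (q : ℝ[X]), q.natDegree ≤ 3 * n + 1 ∧
      r * algebraMap ℝ[X] (RatFunc ℝ) (denPoly d) ^ (n + 1) =
        algebraMap _ _ (C c * X * numPoly a e ^ (n + 1) + denPoly d * q) := by
  simpa [T, basisT_eq_insert] using mem_span_insert_basisCommon_iff hco n X r

/-! ### Nonnegative elements of `S` -/

/-- `RatFunc.eval` uses the reduced fraction and is multiplicative only where denominators do not
vanish. Here the reduced denominator divides D^n, which is nonzero at t. -/
lemma eval_mul_eval_den_pow {d t : ℝ} (ht : t ^ 2 ≠ d) {r : RatFunc ℝ} {q : ℝ[X]} {n : ℕ}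
    (h : r * algebraMap ℝ[X] (RatFunc ℝ) (denPoly d) ^ n = algebraMap _ _ q) :
    RatFunc.eval (RingHom.id ℝ) t r * (t ^ 2 - d) ^ n = q.eval t := by
  have hD : denPoly d ^ n ≠ 0 := pow_ne_zero _ (denPoly_ne_zero d)
  have hr : r = algebraMap ℝ[X] (RatFunc ℝ) q / algebraMap _ _ (denPoly d ^ n) := by
    rw [eq_div_iff (by simpa using hD), map_pow, h]
  have hdvd : r.denom ∣ denPoly d ^ n := by
    rw [hr]
    exact RatFunc.denom_div_dvd q (denPoly d ^ n)
  have hden : Polynomial.eval₂ (RingHom.id ℝ) t r.denom ≠ 0 := by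
    intro h0
    have := eval₂_eq_zero_of_dvd_of_eval₂_eq_zero _ _ hdvd h0
    rw [eval₂_id, eval_pow, eval_denPoly] at this
    exact pow_ne_zero _ (sub_ne_zero.2 ht) this
  have h2 := RatFunc.eval_mul (f := RingHom.id ℝ) (a := t) hden
    (y := algebraMap ℝ[X] (RatFunc ℝ) (denPoly d ^ n)) (by simp only [RatFunc.denom_algebraMap]; simp)
  rw [RatFunc.eval_algebraMap, map_pow, h, RatFunc.eval_algebraMap] at h2
  simpa using h2.symm

lemma finite_setOf_sq_eq (d : ℝ) : {t : ℝ | t ^ 2 = d}.Finite := by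
  refine ((denPoly d).finite_setOfPred_isRoot (denPoly_ne_zero d)).subset fun t ht => ?_
  simpa [sub_eq_zero] using ht

lemma exists_rotation {f₀ f₁ g₀ g₁ : ℝ} (h : f₀ * f₁ + g₀ * g₁ = 0) :
    ∃ u v : ℝ, u ^ 2 + v ^ 2 = 1 ∧ u * f₁ + v * g₁ = 0 ∧ u * g₀ - v * f₀ = 0 := by
  have unit : ∀ x y : ℝ, x ^ 2 + y ^ 2 ≠ 0 →
      (x / √(x ^ 2 + y ^ 2)) ^ 2 + (y / √(x ^ 2 + y ^ 2)) ^ 2 = 1 := by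
    intro x y hxy
    rw [div_pow, div_pow, Real.sq_sqrt (by positivity), ← add_div, div_self hxy]
  -- The vector (u, v) must be orthogonal to (f₁, g₁) and parallel to (f₀, g₀): normalize (g₁, -f₁),
  -- or (f₀, g₀) if the former is zero; if both vanish, any unit vector works.
  by_cases h1 : g₁ ^ 2 + (-f₁) ^ 2 = 0
  · have hf : f₁ = 0 := by nlinarith [sq_nonneg f₁, sq_nonneg g₁]
    have hg : g₁ = 0 := by nlinarith [sq_nonneg f₁, sq_nonneg g₁]
    by_cases h0 : f₀ ^ 2 + g₀ ^ 2 = 0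
    · have hf' : f₀ = 0 := by nlinarith [sq_nonneg f₀, sq_nonneg g₀]
      have hg' : g₀ = 0 := by nlinarith [sq_nonneg f₀, sq_nonneg g₀]
      exact ⟨1, 0, by norm_num, by simp [hf], by simp [hg']⟩
    · exact ⟨_, _, unit _ _ h0, by simp [hf, hg], by ring⟩
  · refine ⟨_, _, unit _ _ h1, by ring, ?_⟩
    linear_combination (1 / √(g₁ ^ 2 + (-f₁) ^ 2)) * h

lemma mul_add_mul_eq_zero_of_den_dvd {d c f₀ f₁ g₀ g₁ : ℝ}
    (h : denPoly d ∣ (C f₀ + C f₁ * X) ^ 2 + (C g₀ + C g₁ * X) ^ 2 - C c) :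
    f₀ * f₁ + g₀ * g₁ = 0 := by
  set A := f₀ ^ 2 + g₀ ^ 2 - c + d * (f₁ ^ 2 + g₁ ^ 2) with hA
  set B := 2 * (f₀ * f₁ + g₀ * g₁) with hB
  have h1 : (C f₀ + C f₁ * X) ^ 2 + (C g₀ + C g₁ * X) ^ 2 - C c =
      denPoly d * C (f₁ ^ 2 + g₁ ^ 2) + (C B * X + C A) := by
    rw [hA, hB, denPoly]
    simp only [C_add, C_sub, C_mul, C_pow]
    rw [show (C (2 : ℝ) : ℝ[X]) = 2 from rfl]
    ring
  rw [h1, dvd_add_right (dvd_mul_right _ _)] at h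
  have h2 : C B * X + C A = 0 := by
    apply eq_zero_of_dvd_of_natDegree_lt h
    rw [natDegree_denPoly]
    exact natDegree_linear_le.trans_lt one_lt_two
  have h3 := congrArg (fun p => coeff p 1) h2
  simp at h3
  linarith

theorem exists_sq_add_sq_of_mem_PosS {a d e : ℝ} (hco : IsCoprime (numPoly a e) (denPoly d))
    (n : ℕ) {p : RatFunc ℝ} (hp : p ∈ PosS a d e (2 * (n + 1))) :
    ∃ f ∈ S a d e (n + 1), ∃ g ∈ T a d e (n + 1), p = f ^ 2 + g ^ 2 := by
  obtain ⟨hpS, hpos⟩ := hp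
  rw [show 2 * (n + 1) = (2 * n + 1) + 1 by ring, mem_S_succ_iff hco] at hpS
  obtain ⟨c, q, hq, hpq⟩ := hpS
  set N := numPoly a e with hN
  set D := denPoly d with hDdef
  set Q := C c * N ^ (2 * n + 1 + 1) + D * q with hQ
  have hQpos : ∀ t, 0 ≤ Q.eval t := by
    refine eval_nonneg_of_finite_compl (finite_setOf_sq_eq d) fun t ht => ?_
    rw [← eval_mul_eval_den_pow ht hpq]
    have h2 : Even (2 * n + 1 + 1) := ⟨n + 1, by ring⟩
    exact mul_nonneg (hpos t ht) (h2.pow_nonneg _)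
  have hQdeg : Q.natDegree ≤ 6 * n + 6 := by
    have h1 : (C c * N ^ (2 * n + 1 + 1)).natDegree ≤ 6 * n + 6 := by
      have := natDegree_linear_mul_pow_le a e c 0 (2 * n + 1 + 1)
      simp only [map_zero, zero_mul, add_zero] at this
      exact this.trans (by omega)
    have h2 : (D * q).natDegree ≤ 6 * n + 6 :=
      (natDegree_mul_le_of_le (natDegree_denPoly d).le hq).trans (by omega)
    simpa using natDegree_add_le_of_le h1 h2
  obtain ⟨F, G, hFG, hF, hG⟩ := exists_two_squares_of_nonneg Q hQpos
  obtain ⟨f₀, f₁, r, hr⟩ := exists_eq_linear_mul_add_den_mul hco (n + 1) F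
  obtain ⟨g₀, g₁, s, hs⟩ := exists_eq_linear_mul_add_den_mul hco (n + 1) G
  have deg : ∀ (α β : ℝ) (F r : ℝ[X]), F = (C α + C β * X) * N ^ (n + 1) + D * r →
      2 * F.natDegree ≤ Q.natDegree → r.natDegree ≤ 3 * n + 1 := fun α β F r h hF =>
    natDegree_of_den_mul_add h (by omega)
      ((natDegree_linear_mul_pow_le a e α β (n + 1)).trans (by omega))
  have hr' := deg f₀ f₁ F r hr hF
  have hs' := deg g₀ g₁ G s hs hG
  have hperp : f₀ * f₁ + g₀ * g₁ = 0 := by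
    apply mul_add_mul_eq_zero_of_den_dvd (d := d) (c := c)
    -- Comparing F² + G² with Q modulo D leaves a common factor N^(2n+2), which is cancelled because
    -- it is prime to D.
    have hco' : IsCoprime D (N ^ (2 * n + 1 + 1)) := hco.symm.pow_right
    refine hco'.dvd_of_dvd_mul_right
      ⟨q - (2 * (C f₀ + C f₁ * X) * N ^ (n + 1) * r + D * r ^ 2) -
        (2 * (C g₀ + C g₁ * X) * N ^ (n + 1) * s + D * s ^ 2), ?_⟩
    rw [hQ, hr, hs] at hFG
    linear_combination -hFG
  obtain ⟨u, v, huv, hv1, hv0⟩ := exists_rotation hperp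
  have hD0 : algebraMap ℝ[X] (RatFunc ℝ) D ^ (n + 1) ≠ 0 :=
    pow_ne_zero _ (algebraMap_denPoly_ne_zero d)
  have hdeg : ∀ x y : ℝ, (C x * r + C y * s).natDegree ≤ 3 * n + 1 := fun x y => by
    simpa using natDegree_add_le_of_le ((natDegree_C_mul_le x r).trans hr')
      ((natDegree_C_mul_le y s).trans hs')
  refine ⟨algebraMap ℝ[X] (RatFunc ℝ) (C u * F + C v * G) / algebraMap _ _ D ^ (n + 1), ?_,
    algebraMap ℝ[X] (RatFunc ℝ) (C (-v) * F + C u * G) / algebraMap _ _ D ^ (n + 1), ?_, ?_⟩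
  · rw [mem_S_succ_iff hco]
    refine ⟨u * f₀ + v * g₀, C u * r + C v * s, hdeg _ _, ?_⟩
    rw [div_mul_cancel₀ _ hD0]
    congr 1
    rw [hr, hs]
    have := congrArg C hv1
    simp only [C_add, C_mul, C_0] at this ⊢
    linear_combination (X * N ^ (n + 1)) * this
  · rw [mem_T_succ_iff hco]
    refine ⟨-v * f₁ + u * g₁, C (-v) * r + C u * s, hdeg _ _, ?_⟩
    rw [div_mul_cancel₀ _ hD0]
    congr 1
    rw [hr, hs]
    have := congrArg C hv0
    simp only [C_add, C_sub, C_mul, C_0, C_neg] at this ⊢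
    linear_combination (N ^ (n + 1)) * this
  · rw [div_pow, div_pow, ← add_div, eq_div_iff (pow_ne_zero _ hD0), ← pow_mul,
      show (n + 1) * 2 = 2 * n + 1 + 1 by ring, hpq, hFG, ← map_pow, ← map_pow, ← map_add]
    congr 1
    have := congrArg C huv
    simp only [C_add, C_pow, C_1] at this
    rw [C_neg]
    linear_combination (-(F ^ 2 + G ^ 2)) * this

lemma exists_sq_of_mem_PosS_zero {a d e : ℝ} {p : RatFunc ℝ} (hp : p ∈ PosS a d e 0) :
    ∃ f ∈ S a d e 0, p = f ^ 2 := by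
  obtain ⟨hpS, hpos⟩ := hp
  have hS : S a d e 0 = Submodule.span ℝ {1} := by
    rw [S]
    congr 1
    ext w
    simp [basisS]
  rw [hS] at hpS ⊢
  obtain ⟨c, rfl⟩ := Submodule.mem_span_singleton.1 hpS
  obtain ⟨t, ht⟩ := (finite_setOf_sq_eq d).infinite_compl.nonempty
  have hc : 0 ≤ c := by
    have := hpos t ht
    rwa [RatFunc.smul_eq_C_mul, mul_one, RatFunc.eval_C] at this
  refine ⟨√c • 1, Submodule.smul_mem _ _ (Submodule.mem_span_singleton_self 1), ?_⟩
  rw [_root_.smul_pow, Real.sq_sqrt hc, one_pow]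

/-! ### Squares of elements of `S` and `T` -/

lemma sq_mem_S_of_mem_S {a d e : ℝ} (hco : IsCoprime (numPoly a e) (denPoly d)) (n : ℕ)
    {f : RatFunc ℝ} (hf : f ∈ S a d e (n + 1)) : f ^ 2 ∈ S a d e (2 * (n + 1)) := by
  rw [mem_S_succ_iff hco] at hf
  rw [show 2 * (n + 1) = (2 * n + 1) + 1 by ring, mem_S_succ_iff hco]
  obtain ⟨c, q, hq, h⟩ := hf
  have hsq := congrArg (· ^ 2) h
  have hN := natDegree_pow_le_of_le (n + 1) (natDegree_numPoly_le a e)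
  refine ⟨c ^ 2, C (2 * c) * numPoly a e ^ (n + 1) * q + denPoly d * q ^ 2, ?_, ?_⟩
  · have h1 : (C (2 * c) * numPoly a e ^ (n + 1) * q).natDegree ≤ 3 * (2 * n + 1) + 1 :=
      (natDegree_mul_le_of_le ((natDegree_C_mul_le _ _).trans hN) hq).trans (by omega)
    have h2 : (denPoly d * q ^ 2).natDegree ≤ 3 * (2 * n + 1) + 1 :=
      (natDegree_mul_le_of_le (natDegree_denPoly d).le (natDegree_pow_le_of_le 2 hq)).trans
        (by omega)
    simpa using natDegree_add_le_of_le h1 h2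
  · rw [← map_pow (algebraMap ℝ[X] (RatFunc ℝ)) (_ + _), mul_pow, ← pow_mul, show (n + 1) * 2 = 2 * n + 1 + 1 by ring] at hsq
    rw [hsq]
    congr 1
    simp only [C_mul, C_pow]
    rw [show (C (2 : ℝ) : ℝ[X]) = 2 from rfl]
    ring

/-- Squaring c t N^(n+1) gives c² t² N^(2n+2), and t² = d + D turns the residue into the constant c²
d required by S. -/
lemma sq_mem_S_of_mem_T {a d e : ℝ} (hco : IsCoprime (numPoly a e) (denPoly d)) (n : ℕ)
    {f : RatFunc ℝ} (hf : f ∈ T a d e (n + 1)) : f ^ 2 ∈ S a d e (2 * (n + 1)) := by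
  rw [mem_T_succ_iff hco] at hf
  rw [show 2 * (n + 1) = (2 * n + 1) + 1 by ring, mem_S_succ_iff hco]
  obtain ⟨c, q, hq, h⟩ := hf
  have hsq := congrArg (· ^ 2) h
  have hN := natDegree_pow_le_of_le (n + 1) (natDegree_numPoly_le a e)
  refine ⟨c ^ 2 * d, C (2 * c) * (X * numPoly a e ^ (n + 1)) * q + denPoly d * q ^ 2 +
    C (c ^ 2) * numPoly a e ^ (n + 1) * numPoly a e ^ (n + 1), ?_, ?_⟩
  · have h0 := natDegree_mul_le_of_le (natDegree_X_le (R := ℝ)) hN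
    have h1 : (C (2 * c) * (X * numPoly a e ^ (n + 1)) * q).natDegree ≤ 3 * (2 * n + 1) + 1 :=
      (natDegree_mul_le_of_le ((natDegree_C_mul_le _ _).trans h0) hq).trans (by omega)
    have h2 : (denPoly d * q ^ 2).natDegree ≤ 3 * (2 * n + 1) + 1 :=
      (natDegree_mul_le_of_le (natDegree_denPoly d).le (natDegree_pow_le_of_le 2 hq)).trans
        (by omega)
    have h3 : (C (c ^ 2) * numPoly a e ^ (n + 1) * numPoly a e ^ (n + 1)).natDegree ≤
        3 * (2 * n + 1) + 1 :=
      (natDegree_mul_le_of_le ((natDegree_C_mul_le _ _).trans hN) hN).trans (by omega)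
    simpa using natDegree_add_le_of_le (natDegree_add_le_of_le h1 h2) h3
  · rw [← map_pow (algebraMap ℝ[X] (RatFunc ℝ)) (_ + _), mul_pow, ← pow_mul, show (n + 1) * 2 = 2 * n + 1 + 1 by ring] at hsq
    rw [hsq]
    congr 1
    simp only [C_mul, C_pow, denPoly]
    rw [show (C (2 : ℝ) : ℝ[X]) = 2 from rfl]
    ring

/-! ### Linear independence of the monomials -/

/-- Only an upper bound on the cardinality: distinctness of the monomials is not known yet and will
follow from the dimension count. -/
lemma exists_finset_basisCommon {A : Type*} [CommRing A] (u v x : A) (n : ℕ) :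
    ∃ F : Finset A, (F : Set A) = insert x (basisCommon u v (n + 1)) ∧ F.card ≤ 3 * (n + 1) := by
  classical
  refine ⟨insert x ((Finset.Icc 1 n ×ˢ Finset.range 2).image (fun p => u ^ p.1 * v ^ p.2) ∪
    (Finset.range (n + 2)).image (v ^ ·)), ?_, ?_⟩
  · rw [Finset.coe_insert, Finset.coe_union, basisCommon]
    congr 2
    · ext w
      simp only [Finset.coe_image, Set.mem_image, Finset.mem_coe, Finset.mem_product,
        Finset.mem_Icc, Finset.mem_range, Prod.exists, Set.mem_ofPred_eq]
      constructor
      · rintro ⟨j, l, ⟨⟨h1, h2⟩, h3⟩, rfl⟩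
        refine ⟨j, h1, by omega, ?_⟩
        interval_cases l <;> simp
      · rintro ⟨j, h1, h2, rfl | rfl⟩
        · exact ⟨j, 0, ⟨⟨h1, by omega⟩, by omega⟩, by simp⟩
        · exact ⟨j, 1, ⟨⟨h1, by omega⟩, by omega⟩, by simp⟩
    · ext w
      simp only [Finset.coe_image, Set.mem_image, Finset.mem_coe, Finset.mem_range,
        Set.mem_ofPred_eq]
      exact ⟨fun ⟨l, h, e⟩ => ⟨l, by omega, e.symm⟩, fun ⟨l, h, e⟩ => ⟨l, by omega, e.symm⟩⟩
  · refine (Finset.card_insert_le _ _).trans ?_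
    have h1 := Finset.card_union_le
      ((Finset.Icc 1 n ×ˢ Finset.range 2).image (fun p => u ^ p.1 * v ^ p.2))
      ((Finset.range (n + 2)).image (v ^ ·))
    have h2 := Finset.card_image_le (s := Finset.Icc 1 n ×ˢ Finset.range 2)
      (f := fun p => u ^ p.1 * v ^ p.2)
    have h3 := Finset.card_image_le (s := Finset.range (n + 2)) (f := (v ^ ·))
    simp only [Finset.card_product, Nat.card_Icc, Finset.card_range] at h2 h3
    omega

/-- The map (c, q) ↦ (c w N^(n+1) + D q) / D^(n+1) is injective into the span, from a space of
dimension 1 + (3n + 2). Together with the bound on the number of generators this forces linear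
independence. -/
theorem le_finrank_span_insert_basisCommon {a d e : ℝ}
    (hco : IsCoprime (numPoly a e) (denPoly d)) (n : ℕ) (w : ℝ[X]) (hw : ¬ denPoly d ∣ w) :
    3 * (n + 1) ≤ Module.finrank ℝ (Submodule.span ℝ
      (insert (h3 a d e ^ (n + 1) * algebraMap ℝ[X] (RatFunc ℝ) w)
        (basisCommon (h3 a d e) RatFunc.X (n + 1)))) := by
  set U := Submodule.span ℝ
      (insert (h3 a d e ^ (n + 1) * algebraMap ℝ[X] (RatFunc ℝ) w)
        (basisCommon (h3 a d e) RatFunc.X (n + 1))) with hU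
  have hD := algebraMap_denPoly_ne_zero d
  let L : ℝ[X] →ₗ[ℝ] RatFunc ℝ :=
    (LinearMap.mulRight ℝ ((algebraMap ℝ[X] (RatFunc ℝ) (denPoly d) ^ (n + 1))⁻¹)) ∘ₗ
      (IsScalarTower.toAlgHom ℝ ℝ[X] (RatFunc ℝ)).toLinearMap
  let M : ℝ × degreeLT ℝ (3 * n + 2) →ₗ[ℝ] ℝ[X] :=
    (LinearMap.toSpanSingleton ℝ ℝ[X] (w * numPoly a e ^ (n + 1))).coprod
      ((LinearMap.mulLeft ℝ (denPoly d)) ∘ₗ (degreeLT ℝ (3 * n + 2)).subtype)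
  have hL : ∀ q, L q * algebraMap ℝ[X] (RatFunc ℝ) (denPoly d) ^ (n + 1) = algebraMap _ _ q :=
    fun q => by simp [L, mul_assoc, inv_mul_cancel₀ (pow_ne_zero (n + 1) hD)]
  have hLinj : Function.Injective L := fun p q hpq => by
    have h1 := hL p
    rw [hpq, hL q] at h1
    exact (RatFunc.algebraMap_injective ℝ h1).symm
  have hM : ∀ x, M x = C x.1 * w * numPoly a e ^ (n + 1) + denPoly d * (x.2 : ℝ[X]) := fun x => by
    simp [M, smul_eq_C_mul, mul_assoc]
  have hMinj : Function.Injective M := by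
    rw [injective_iff_map_eq_zero]
    rintro ⟨c, q⟩ h
    rw [hM] at h
    -- Modulo D the equation reads c w N^(n+1) ≡ 0; N is invertible there and w is not zero.
    have hc : c = 0 := by
      by_contra hc
      apply hw
      have hco' : IsCoprime (denPoly d) (numPoly a e ^ (n + 1)) := hco.symm.pow_right
      have h1 : denPoly d ∣ C c * w :=
        hco'.dvd_of_dvd_mul_right ⟨-(q : ℝ[X]), by linear_combination h⟩
      rwa [IsUnit.dvd_mul_left (isUnit_C.2 (isUnit_iff_ne_zero.2 hc))] at h1
    subst hc
    simp only [map_zero, zero_mul, zero_add, mul_eq_zero, denPoly_ne_zero, false_or] at h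
    exact Prod.ext rfl (Subtype.ext h)
  have hrange : LinearMap.range (L ∘ₗ M) ≤ U := by
    rintro _ ⟨x, rfl⟩
    rw [hU, mem_span_insert_basisCommon_iff hco]
    refine ⟨x.1, x.2, ?_, by rw [← hM, LinearMap.comp_apply, hL]⟩
    have := mem_degreeLT.1 x.2.2
    rw [degree_lt_iff_coeff_zero] at this
    exact natDegree_le_iff_coeff_eq_zero.2 fun m hm => this m hm
  obtain ⟨F, hF, -⟩ := exists_finset_basisCommon (h3 a d e) RatFunc.X
    (h3 a d e ^ (n + 1) * algebraMap ℝ[X] (RatFunc ℝ) w) n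
  have : FiniteDimensional ℝ U := by
    rw [hU, ← hF]
    infer_instance
  have h1 := Submodule.finrank_mono hrange
  rw [LinearMap.finrank_range_of_inj (f := L ∘ₗ M) (hLinj.comp hMinj), Module.finrank_prod,
    (degreeLTEquiv ℝ (3 * n + 2)).finrank_eq] at h1
  simp at h1
  omega

lemma linearIndepOn_of_card_le_finrank {E : Type*} [AddCommGroup E] [Module ℝ E] (F : Finset E)
    (h : F.card ≤ Module.finrank ℝ (Submodule.span ℝ (F : Set E))) :
    LinearIndepOn ℝ id (F : Set E) := by
  rw [LinearIndepOn, linearIndependent_iff_card_le_finrank_span, Set.finrank]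
  have h1 : Set.range (fun x : (F : Set E) => id (x : E)) = F := Subtype.range_coe
  rw [h1]
  simpa using h

theorem linearIndepOn_insert_basisCommon {a d e : ℝ}
    (hco : IsCoprime (numPoly a e) (denPoly d)) (n : ℕ) (w : ℝ[X]) (hw : ¬ denPoly d ∣ w) :
    LinearIndepOn ℝ id (insert (h3 a d e ^ (n + 1) * algebraMap ℝ[X] (RatFunc ℝ) w)
        (basisCommon (h3 a d e) RatFunc.X (n + 1))) ∧
      Module.finrank ℝ (Submodule.span ℝ
        (insert (h3 a d e ^ (n + 1) * algebraMap ℝ[X] (RatFunc ℝ) w)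
          (basisCommon (h3 a d e) RatFunc.X (n + 1)))) = 3 * (n + 1) := by
  have h1 := le_finrank_span_insert_basisCommon hco n w hw
  obtain ⟨F, hF, hcard⟩ := exists_finset_basisCommon (h3 a d e) RatFunc.X
    (h3 a d e ^ (n + 1) * algebraMap ℝ[X] (RatFunc ℝ) w) n
  rw [← hF] at h1 ⊢
  exact ⟨linearIndepOn_of_card_le_finrank F (hcard.trans h1),
    le_antisymm ((finrank_span_finset_le_card F).trans hcard) h1⟩

lemma not_denPoly_dvd_of_natDegree_lt {d : ℝ} {w : ℝ[X]} (h0 : w ≠ 0) (hw : w.natDegree < 2) :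
    ¬ denPoly d ∣ w := fun h =>
  h0 (eq_zero_of_dvd_of_natDegree_lt h (by rwa [natDegree_denPoly]))

theorem linearIndepOn_basisS {a d e : ℝ} (hco : IsCoprime (numPoly a e) (denPoly d)) (n : ℕ) :
    LinearIndepOn ℝ id (basisS (h3 a d e) RatFunc.X (n + 1)) := by
  have := linearIndepOn_insert_basisCommon hco n 1
    (not_denPoly_dvd_of_natDegree_lt one_ne_zero (by simp))
  rw [basisS_eq_insert]
  simpa using this.1

theorem linearIndepOn_basisT {a d e : ℝ} (hco : IsCoprime (numPoly a e) (denPoly d)) (n : ℕ) :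
    LinearIndepOn ℝ id (basisT (h3 a d e) RatFunc.X (n + 1)) := by
  have := linearIndepOn_insert_basisCommon hco n X
    (not_denPoly_dvd_of_natDegree_lt X_ne_zero (by simp))
  rw [basisT_eq_insert]
  simpa using this.1

theorem finrank_T {a d e : ℝ} (hco : IsCoprime (numPoly a e) (denPoly d)) (n : ℕ) :
    Module.finrank ℝ (T a d e (n + 1)) = 3 * (n + 1) := by
  have := linearIndepOn_insert_basisCommon hco n X
    (not_denPoly_dvd_of_natDegree_lt X_ne_zero (by simp))
  rw [T, basisT_eq_insert]
  rw [RatFunc.algebraMap_X] at this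
  exact this.2

/-! ### The parametrization of the curve -/

/-- The point of the curve with parameter `t`. -/
noncomputable def curvePoint (a d e t : ℝ) : Fin 2 → ℝ := ![(-a * t + e) / (t ^ 2 - d), t]

lemma mem_curve {a d e : ℝ} {z : Fin 2 → ℝ} :
    z ∈ curve a d e ↔ z 0 * (z 1 ^ 2 - d) = -a * z 1 + e := by
  simp only [curve, cubic, Set.mem_ofPred_eq, map_sub, map_add, map_mul, map_pow,
    MvPolynomial.eval_X, MvPolynomial.eval_C]
  constructor <;> intro h <;> linear_combination h

lemma curvePoint_mem (a e : ℝ) {d t : ℝ} (ht : t ^ 2 ≠ d) : curvePoint a d e t ∈ curve a d e := by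
  simp [mem_curve, curvePoint, div_mul_cancel₀ _ (sub_ne_zero.2 ht)]

/-- A point of the curve with y² = d would make y a common root of N and D. -/
lemma sq_ne_of_mem_curve {a d e : ℝ} (hco : IsCoprime (numPoly a e) (denPoly d))
    {z : Fin 2 → ℝ} (hz : z ∈ curve a d e) : z 1 ^ 2 ≠ d := by
  intro h
  rw [mem_curve, h, sub_self, mul_zero] at hz
  obtain ⟨u, v, huv⟩ := hco
  have := congrArg (eval (z 1)) huv
  rw [eval_add, eval_mul, eval_mul, eval_numPoly, eval_denPoly, h, ← hz] at this
  simp at this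

lemma eq_curvePoint_of_mem_curve {a d e : ℝ} (hco : IsCoprime (numPoly a e) (denPoly d))
    {z : Fin 2 → ℝ} (hz : z ∈ curve a d e) : z = curvePoint a d e (z 1) := by
  have h := sq_ne_of_mem_curve hco hz
  rw [mem_curve] at hz
  ext i
  fin_cases i
  · exact (eq_div_iff (sub_ne_zero.2 h)).2 hz
  · simp [curvePoint]

lemma curvePoint_mem_nonIsolated (a e : ℝ) {d t : ℝ} (ht : t ^ 2 ≠ d) :
    curvePoint a d e t ∈ nonIsolated (curve a d e) := by
  refine ⟨curvePoint_mem a e ht, accPt_iff_nhds.2 fun U hU => ?_⟩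
  have hne : ∀ᶠ s in nhds t, s ^ 2 ≠ d :=
    (continuousAt_id.pow 2).eventually_ne ht
  have hcont : ContinuousAt (curvePoint a d e) t := by
    refine continuousAt_pi.2 fun i => ?_
    fin_cases i
    · refine ContinuousAt.div (by fun_prop) (by fun_prop) (sub_ne_zero.2 ht)
    · exact continuousAt_id
  have hev := (hne.and (hcont.eventually_mem hU)).filter_mono (nhdsWithin_le_nhds (s := {t}ᶜ))
  obtain ⟨s, ⟨hs, hsU⟩, hst⟩ := (hev.and self_mem_nhdsWithin).exists
  exact ⟨_, ⟨hsU, curvePoint_mem a e hs⟩, fun h => hst (congrFun h 1)⟩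

/-- The point is that one q serves both for the substitution in ℝ(t) and for the values at curve
points, which links identities of rational functions to pointwise ones. -/
lemma exists_numerator (a d e : ℝ) (F : MvPolynomial (Fin 2) ℝ) :
    ∃ (m : ℕ) (q : ℝ[X]),
      MvPolynomial.aeval ![h3 a d e, RatFunc.X] F *
          algebraMap ℝ[X] (RatFunc ℝ) (denPoly d) ^ m = algebraMap _ _ q ∧
        ∀ t : ℝ, t ^ 2 ≠ d →
          MvPolynomial.aeval (curvePoint a d e t) F * (t ^ 2 - d) ^ m = q.eval t := by
  induction F using MvPolynomial.induction_on with
  | C c => exact ⟨0, C c, by simp [RatFunc.algebraMap_eq_C], by simp⟩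
  | add F G hF hG =>
    obtain ⟨m, p, h1, h2⟩ := hF
    obtain ⟨n, q, h3, h4⟩ := hG
    refine ⟨m + n, p * denPoly d ^ n + q * denPoly d ^ m, ?_, fun t ht => ?_⟩
    · simp only [map_add, map_mul, map_pow, ← h1, ← h3]
      ring
    · simp only [map_add, eval_add, eval_mul, eval_pow, eval_denPoly, ← h2 t ht, ← h4 t ht]
      ring
  | mul_X F i hF =>
    obtain ⟨m, p, h1, h2⟩ := hF
    fin_cases i
    · refine ⟨m + 1, p * numPoly a e, ?_, fun t ht => ?_⟩
      · simp only [map_mul, MvPolynomial.aeval_X, ← h1, ← h3_mul_den a d e]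
        simp
        ring
      · have : curvePoint a d e t 0 * (t ^ 2 - d) = -a * t + e := by
          simp [curvePoint, div_mul_cancel₀ _ (sub_ne_zero.2 ht)]
        simp only [map_mul, MvPolynomial.aeval_X, eval_mul, eval_numPoly, ← h2 t ht, ← this,
          Fin.zero_eta]
        ring
    · refine ⟨m, p * X, ?_, fun t ht => ?_⟩
      · simp only [map_mul, MvPolynomial.aeval_X, ← h1]
        simp
        ring
      · simp only [map_mul, MvPolynomial.aeval_X, eval_mul, ← h2 t ht]
        simp [curvePoint]
        ring

lemma aeval_curvePoint_mul_den_pow {a d e t : ℝ} (ht : t ^ 2 ≠ d) {F : MvPolynomial (Fin 2) ℝ}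
    {m : ℕ} {q : ℝ[X]}
    (h : MvPolynomial.aeval ![h3 a d e, RatFunc.X] F *
      algebraMap ℝ[X] (RatFunc ℝ) (denPoly d) ^ m = algebraMap _ _ q) :
    MvPolynomial.aeval (curvePoint a d e t) F * (t ^ 2 - d) ^ m = q.eval t := by
  obtain ⟨n, p, h1, h2⟩ := exists_numerator a d e F
  have h3 : p * denPoly d ^ m = q * denPoly d ^ n := by
    apply RatFunc.algebraMap_injective ℝ
    simp only [map_mul, map_pow, ← h, ← h1]
    ring
  have h4 := congrArg (eval t) h3
  simp only [eval_mul, eval_pow, eval_denPoly, ← h2 t ht] at h4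
  apply mul_right_cancel₀ (pow_ne_zero n (sub_ne_zero.2 ht))
  linear_combination h4

lemma aeval_eq_zero_of_mem_vanishingIdeal {a d e : ℝ} {F : MvPolynomial (Fin 2) ℝ}
    (hF : F ∈ MvPolynomial.vanishingIdeal ℝ (curve a d e)) :
    MvPolynomial.aeval ![h3 a d e, RatFunc.X] F = 0 := by
  obtain ⟨n, p, h1, h2⟩ := exists_numerator a d e F
  have hp : p = 0 := by
    refine eq_zero_of_infinite_isRoot p ((finite_setOf_sq_eq d).infinite_compl.mono ?_)
    intro t ht
    change p.eval t = 0
    rw [← h2 t ht, hF _ (curvePoint_mem a e ht), zero_mul]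
  rw [hp, map_zero] at h1
  exact (mul_eq_zero.1 h1).resolve_right (pow_ne_zero _ (algebraMap_denPoly_ne_zero d))

/-- The homomorphism `ℝ[C] → ℝ(t)` with `x ↦ h₃` and `y ↦ t`. -/
noncomputable def paramHom (a d e : ℝ) : CoordRing (curve a d e) →ₐ[ℝ] RatFunc ℝ :=
  Ideal.Quotient.liftₐ (MvPolynomial.vanishingIdeal ℝ (curve a d e))
    (MvPolynomial.aeval ![h3 a d e, RatFunc.X]) fun _ h => aeval_eq_zero_of_mem_vanishingIdeal h

@[simp] lemma paramHom_restrict (a d e : ℝ) (F : MvPolynomial (Fin 2) ℝ) :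
    paramHom a d e (restrict (curve a d e) F) =
      MvPolynomial.aeval ![h3 a d e, RatFunc.X] F := rfl

@[simp] lemma paramHom_xC (a d e : ℝ) : paramHom a d e (xC a d e) = h3 a d e := by simp [xC]

@[simp] lemma paramHom_yC (a d e : ℝ) : paramHom a d e (yC a d e) = RatFunc.X := by simp [yC]

lemma evalAt_curvePoint_mul_den_pow {a d e t : ℝ} (ht : t ^ 2 ≠ d)
    {p : CoordRing (curve a d e)} {m : ℕ} {q : ℝ[X]}
    (h : paramHom a d e p * algebraMap ℝ[X] (RatFunc ℝ) (denPoly d) ^ m = algebraMap _ _ q) :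
    evalAt (curve a d e) ⟨curvePoint a d e t, curvePoint_mem a e ht⟩ p * (t ^ 2 - d) ^ m =
      q.eval t := by
  obtain ⟨F, rfl⟩ := Ideal.Quotient.mk_surjective p
  exact aeval_curvePoint_mul_den_pow ht h

lemma evalAt_curvePoint {a d e t : ℝ} (ht : t ^ 2 ≠ d) (p : CoordRing (curve a d e)) :
    evalAt (curve a d e) ⟨curvePoint a d e t, curvePoint_mem a e ht⟩ p =
      RatFunc.eval (RingHom.id ℝ) t (paramHom a d e p) := by
  obtain ⟨F, rfl⟩ := Ideal.Quotient.mk_surjective p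
  obtain ⟨n, q, h1, h2⟩ := exists_numerator a d e F
  apply mul_right_cancel₀ (pow_ne_zero n (sub_ne_zero.2 ht))
  rw [evalAt_curvePoint_mul_den_pow ht h1]
  exact (eval_mul_eval_den_pow ht h1).symm

/-- Every point of C is parametrized, so a polynomial whose pullback is zero vanishes on all of C.
-/
lemma paramHom_injective {a d e : ℝ} (hco : IsCoprime (numPoly a e) (denPoly d)) :
    Function.Injective (paramHom a d e) := by
  rw [injective_iff_map_eq_zero]
  intro p hp
  obtain ⟨F, rfl⟩ := Ideal.Quotient.mk_surjective p
  refine Ideal.Quotient.eq_zero_iff_mem.2 fun z hz => ?_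
  rw [eq_curvePoint_of_mem_curve hco hz]
  have := aeval_curvePoint_mul_den_pow (a := a) (e := e) (sq_ne_of_mem_curve hco hz) (F := F)
    (m := 0) (q := 0)
    (by rw [map_zero, pow_zero, mul_one]; exact hp)
  simpa using this

lemma isUnit_paramHom {a d e : ℝ} (hco : IsCoprime (numPoly a e) (denPoly d))
    (b : nonZeroDivisors (CoordRing (curve a d e))) : IsUnit (paramHom a d e b) := by
  have : Nontrivial (CoordRing (curve a d e)) := (paramHom a d e).toRingHom.domain_nontrivial
  exact isUnit_iff_ne_zero.2 ((map_ne_zero_iff _ (paramHom_injective hco)).2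
    (nonZeroDivisors.coe_ne_zero b))

/-- The extension of `paramHom` to the total ring of fractions. -/
noncomputable def fracHom {a d e : ℝ} (hco : IsCoprime (numPoly a e) (denPoly d)) :
    TotalFrac (curve a d e) →ₐ[ℝ] RatFunc ℝ :=
  IsLocalization.liftAlgHom (M := nonZeroDivisors (CoordRing (curve a d e)))
    (f := paramHom a d e) (isUnit_paramHom hco)

@[simp] lemma fracHom_algebraMap {a d e : ℝ} (hco : IsCoprime (numPoly a e) (denPoly d))
    (p : CoordRing (curve a d e)) :
    fracHom hco (algebraMap _ (TotalFrac (curve a d e)) p) = paramHom a d e p := by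
  rw [fracHom, IsLocalization.liftAlgHom_apply]
  exact IsLocalization.lift_eq _ _

lemma fracHom_injective {a d e : ℝ} (hco : IsCoprime (numPoly a e) (denPoly d)) :
    Function.Injective (fracHom hco) := by
  rw [injective_iff_map_eq_zero]
  intro x hx
  obtain ⟨⟨p, b⟩, h⟩ := IsLocalization.surj (nonZeroDivisors (CoordRing (curve a d e))) x
  have h1 := congrArg (fracHom hco) h
  rw [map_mul, hx, zero_mul, fracHom_algebraMap] at h1
  have hp : p = 0 := paramHom_injective hco (by rw [← h1, map_zero])
  have hb := IsLocalization.map_units (TotalFrac (curve a d e)) b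
  simp only [hp, map_zero] at h
  exact hb.mul_left_eq_zero.1 h

/-! ### Transfer of the spaces of functions -/

lemma image_basisCommon {A B F : Type*} [CommRing A] [CommRing B] [FunLike F A B]
    [RingHomClass F A B] (f : F) (u v : A) (i : ℕ) :
    f '' basisCommon u v i = basisCommon (f u) (f v) i := by
  ext w
  constructor
  · rintro ⟨_, ⟨j, h1, h2, rfl | rfl⟩ | ⟨l, hl, rfl⟩, rfl⟩
    · exact Or.inl ⟨j, h1, h2, Or.inl (by simp)⟩
    · exact Or.inl ⟨j, h1, h2, Or.inr (by simp)⟩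
    · exact Or.inr ⟨l, hl, by simp⟩
  · rintro (⟨j, h1, h2, rfl | rfl⟩ | ⟨l, hl, rfl⟩)
    · exact ⟨u ^ j, Or.inl ⟨j, h1, h2, Or.inl rfl⟩, by simp⟩
    · exact ⟨u ^ j * v, Or.inl ⟨j, h1, h2, Or.inr rfl⟩, by simp⟩
    · exact ⟨v ^ l, Or.inr ⟨l, hl, rfl⟩, by simp⟩

lemma image_basisS {A B F : Type*} [CommRing A] [CommRing B] [FunLike F A B]
    [RingHomClass F A B] (f : F) (u v : A) (i : ℕ) :
    f '' basisS u v i = basisS (f u) (f v) i := by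
  rw [basisS_eq_insert, basisS_eq_insert, Set.image_insert_eq, image_basisCommon]
  simp

lemma image_basisT {A B F : Type*} [CommRing A] [CommRing B] [FunLike F A B]
    [RingHomClass F A B] (f : F) (u v : A) (i : ℕ) :
    f '' basisT u v i = basisT (f u) (f v) i := by
  rw [basisT_eq_insert, basisT_eq_insert, Set.image_insert_eq, image_basisCommon]
  simp

lemma paramHom_image_basisB (a d e : ℝ) (k : ℕ) :
    paramHom a d e '' basisB a d e k = basisS (h3 a d e) RatFunc.X k := by
  rw [basisB, image_basisS, paramHom_xC, paramHom_yC]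

lemma fracHom_image_basisV {a d e : ℝ} (hco : IsCoprime (numPoly a e) (denPoly d)) (k : ℕ) :
    fracHom hco '' basisV a d e k = basisT (h3 a d e) RatFunc.X k := by
  rw [basisV, image_basisT, fracHom_algebraMap, fracHom_algebraMap, paramHom_xC, paramHom_yC]

lemma map_span_basisB (a d e : ℝ) (k : ℕ) :
    (Submodule.span ℝ (basisB a d e k)).map (paramHom a d e).toLinearMap = S a d e k := by
  rw [Submodule.map_span, AlgHom.coe_toLinearMap, paramHom_image_basisB, S]

lemma map_V {a d e : ℝ} (hco : IsCoprime (numPoly a e) (denPoly d)) (k : ℕ) :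
    (V a d e k).map (fracHom hco).toLinearMap = T a d e k := by
  rw [V, Submodule.map_span, AlgHom.coe_toLinearMap, fracHom_image_basisV, T]

lemma linearIndepOn_id_of_image {A B : Type*} [AddCommGroup A] [Module ℝ A] [AddCommGroup B]
    [Module ℝ B] (f : A →ₗ[ℝ] B) (hf : Function.Injective f) {s : Set A}
    (h : LinearIndepOn ℝ id (f '' s)) : LinearIndepOn ℝ id s :=
  LinearIndepOn.of_comp f ((linearIndepOn_iff_image hf.injOn).2 h)

/-- The monomials missing from the basis need no explicit reduction by the cubic: over D^n their
numerators have degree at most 3n + 1. Only the pure power m = n + 1 has too large a denominator,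
and it is a generator. -/
lemma h3_pow_mul_X_pow_mem_S {a d e : ℝ} (hco : IsCoprime (numPoly a e) (denPoly d)) {m l n : ℕ}
    (h : m + l ≤ n + 1) : h3 a d e ^ m * RatFunc.X ^ l ∈ S a d e (n + 1) := by
  by_cases hm : m ≤ n
  · rw [S, basisS_eq_insert]
    refine Submodule.span_mono (Set.subset_insert _ _) ((mem_span_basisCommon_iff hco n _).2 ?_)
    exact ⟨_, by have := natDegree_num_mul_X_mul_den_le a d e hm l; omega,
      h3_pow_mul_X_pow_mul_den_pow a d e hm l⟩
  · obtain rfl : m = n + 1 := by omega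
    obtain rfl : l = 0 := by omega
    rw [S, basisS_eq_insert, pow_zero]
    exact Submodule.subset_span (Set.mem_insert _ _)

lemma map_coordDegLE_le {a d e : ℝ} (hco : IsCoprime (numPoly a e) (denPoly d)) (n : ℕ) :
    (coordDegLE (curve a d e) (n + 1)).map (paramHom a d e).toLinearMap ≤ S a d e (n + 1) := by
  rintro _ ⟨_, ⟨F, hF, rfl⟩, rfl⟩
  have hF' := (MvPolynomial.mem_restrictTotalDegree _ _ _).1 hF
  simp only [AlgHom.toLinearMap_apply, paramHom_restrict]
  rw [F.as_sum, map_sum]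
  refine Submodule.sum_mem _ fun s hs => ?_
  rw [MvPolynomial.aeval_monomial, ← Algebra.smul_def]
  refine Submodule.smul_mem _ _ ?_
  have hs' := MvPolynomial.le_totalDegree hs
  rw [Finsupp.sum_fintype _ _ (fun _ => rfl), Fin.sum_univ_two] at hs'
  rw [Finsupp.prod_fintype _ _ (fun _ => pow_zero _), Fin.prod_univ_two]
  exact h3_pow_mul_X_pow_mem_S hco (hs'.trans hF')

lemma span_basisB_le {a d e : ℝ} (n : ℕ) :
    Submodule.span ℝ (basisB a d e (n + 1)) ≤ coordDegLE (curve a d e) (n + 1) := by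
  have mono : ∀ j l, j + l ≤ n + 1 → xC a d e ^ j * yC a d e ^ l ∈
      coordDegLE (curve a d e) (n + 1) := fun j l h => by
    refine ⟨MvPolynomial.X 0 ^ j * MvPolynomial.X 1 ^ l,
      (MvPolynomial.mem_restrictTotalDegree _ _ _).2 ?_, by simp [xC, yC]⟩
    refine (MvPolynomial.totalDegree_mul _ _).trans ?_
    rwa [MvPolynomial.totalDegree_X_pow, MvPolynomial.totalDegree_X_pow]
  rw [Submodule.span_le, basisB, basisS_eq_insert]
  rintro _ (rfl | ⟨j, h1, h2, rfl | rfl⟩ | ⟨l, hl, rfl⟩)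
  · simpa using mono (n + 1) 0 (by omega)
  · simpa using mono j 0 (by omega)
  · simpa using mono j 1 (by omega)
  · simpa using mono 0 l (by omega)

theorem span_basisB {a d e : ℝ} (hco : IsCoprime (numPoly a e) (denPoly d)) (n : ℕ) :
    Submodule.span ℝ (basisB a d e (n + 1)) = coordDegLE (curve a d e) (n + 1) := by
  refine le_antisymm (span_basisB_le n) ?_
  have h := map_coordDegLE_le hco n
  rw [← map_span_basisB] at h
  exact (Submodule.map_le_map_iff_of_injective (paramHom_injective hco) _ _).1 h

lemma mem_coordDegLE_iff {a d e : ℝ} (hco : IsCoprime (numPoly a e) (denPoly d)) (n : ℕ)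
    (p : CoordRing (curve a d e)) :
    p ∈ coordDegLE (curve a d e) (n + 1) ↔ paramHom a d e p ∈ S a d e (n + 1) := by
  rw [← span_basisB hco, ← map_span_basisB]
  exact (Function.Injective.mem_set_image (paramHom_injective hco)).symm

lemma mem_V_iff {a d e : ℝ} (hco : IsCoprime (numPoly a e) (denPoly d)) (k : ℕ)
    (h : TotalFrac (curve a d e)) : h ∈ V a d e k ↔ fracHom hco h ∈ T a d e k := by
  rw [← map_V hco]
  exact (Function.Injective.mem_set_image (fracHom_injective hco)).symm

/-! ### Irreducibility -/

lemma isCoprime_of_irreducible_cubic {a d e : ℝ} (hP : Irreducible (cubic a d e)) :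
    IsCoprime (numPoly a e) (denPoly d) := by
  rw [← EuclideanDomain.gcd_isUnit_iff]
  obtain ⟨N', hN⟩ := EuclideanDomain.gcd_dvd_left (numPoly a e) (denPoly d)
  obtain ⟨D', hD⟩ := EuclideanDomain.gcd_dvd_right (numPoly a e) (denPoly d)
  set g := EuclideanDomain.gcd (numPoly a e) (denPoly d)
  let ι : ℝ[X] →ₐ[ℝ] MvPolynomial (Fin 2) ℝ := aeval (MvPolynomial.X 1)
  -- The cubic is x D(y) - N(y), so the gcd g splits off as a factor in y alone.
  have hfac : cubic a d e = ι g * (MvPolynomial.X 0 * ι D' - ι N') := by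
    rw [mul_sub, mul_left_comm, ← map_mul, ← map_mul, ← hN, ← hD]
    simp [cubic, numPoly, denPoly, ι, MvPolynomial.algebraMap_eq]
    ring
  rcases hP.isUnit_or_isUnit hfac with h | h
  · have h1 := h.map (MvPolynomial.aeval (R := ℝ) ![(0 : ℝ[X]), X])
    have h2 : (MvPolynomial.aeval (R := ℝ) ![(0 : ℝ[X]), X]).comp ι = AlgHom.id ℝ ℝ[X] := by
      ext
      simp [ι]
    rwa [← AlgHom.comp_apply, h2] at h1
  · exfalso
    obtain ⟨c, -, hc⟩ := MvPolynomial.isUnit_iff_eq_C_of_isReduced.1 h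
    have hι : ∀ (x t : ℝ) (q : ℝ[X]), MvPolynomial.eval ![x, t] (ι q) = q.eval t := by
      intro x t q
      have : ((MvPolynomial.aeval (R := ℝ) ![x, t]).comp ι) = aeval t := by
        ext
        simp [ι]
      simpa [MvPolynomial.aeval_eq_eval, coe_aeval_eq_eval] using DFunLike.congr_fun this q
    -- If x D'(y) - N'(y) were constant, its values at x = 0 and x = 1 would agree, leaving D' = 0.
    have hD0 : D' = 0 := by
      refine Polynomial.funext fun t => ?_
      have h0 := congrArg (MvPolynomial.eval ![0, t]) hc
      have h1 := congrArg (MvPolynomial.eval ![1, t]) hc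
      simp [hι] at h0 h1
      simp
      linarith
    exact denPoly_ne_zero d (by rw [hD, hD0, mul_zero])

/-! ### The certificate -/

lemma evalAt_nonneg_of_eq_sum_sq {C : Set (Fin 2 → ℝ)} (z : C) {m : ℕ}
    (g : Fin m → CoordRing C) : 0 ≤ evalAt C z (∑ i, g i ^ 2) := by
  rw [map_sum]
  exact Finset.sum_nonneg fun i _ => by rw [map_pow]; positivity

theorem isCertificatePair {a d e : ℝ} (hco : IsCoprime (numPoly a e) (denPoly d)) :
    IsCertificatePair (curve a d e) 1 (V a d e) := by
  intro k hk
  obtain ⟨n, rfl⟩ : ∃ n, k = n + 1 := ⟨k - 1, by omega⟩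
  have h2 : 2 * (n + 1) = 2 * n + 1 + 1 := by ring
  refine ⟨?_, fun p => ⟨?_, ?_⟩⟩
  · rw [← finrank_T hco, ← map_V hco]
    exact (Submodule.equivMapOfInjective _ (fracHom_injective hco) _).finrank_eq
  · rintro ⟨hp, hpos⟩
    have hp' : paramHom a d e p ∈ PosS a d e (2 * (n + 1)) := by
      refine ⟨by rw [h2] at hp ⊢; exact (mem_coordDegLE_iff hco _ p).1 hp, fun t ht => ?_⟩
      rw [← evalAt_curvePoint ht]
      exact hpos _ (curvePoint_mem_nonIsolated a e ht)
    obtain ⟨f, hf, g, hg, hfg⟩ := exists_sq_add_sq_of_mem_PosS hco n hp'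
    rw [← map_span_basisB, span_basisB hco] at hf
    rw [← map_V hco] at hg
    obtain ⟨f, hf, rfl⟩ := hf
    obtain ⟨g, hg, rfl⟩ := hg
    refine ⟨1, 1, fun _ => f, fun _ => g, fun _ => hf, fun _ => hg, fracHom_injective hco ?_⟩
    simpa using hfg
  · rintro ⟨m, l, g, h, hg, hh, hp⟩
    have hp' := congrArg (fracHom hco) hp
    simp only [one_mul, map_add, map_sum, map_pow, fracHom_algebraMap] at hp'
    refine ⟨?_, fun z _ => ?_⟩
    · rw [h2, mem_coordDegLE_iff hco, ← h2, hp']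
      exact add_mem
        (sum_mem fun i _ => sq_mem_S_of_mem_S hco n ((mem_coordDegLE_iff hco n _).1 (hg i)))
        (sum_mem fun j _ => sq_mem_S_of_mem_T hco n ((mem_V_iff hco _ _).1 (hh j)))
    · have hz := sq_ne_of_mem_curve hco z.2
      have hzeq : z = ⟨curvePoint a d e (z.1 1), curvePoint_mem a e hz⟩ :=
        Subtype.ext (eq_curvePoint_of_mem_curve hco z.2)
      have hnum : ∀ j, ∃ q : ℝ[X], fracHom hco (h j) *
          algebraMap ℝ[X] (RatFunc ℝ) (denPoly d) ^ (n + 1) = algebraMap _ _ q := fun j => by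
        obtain ⟨_, _, _, h⟩ := (mem_T_succ_iff hco n _).1 ((mem_V_iff hco _ _).1 (hh j))
        exact ⟨_, h⟩
      choose q hq using hnum
      -- The h j live in the fraction ring, where `evalAt` is not defined; their squares are handled
      -- through p - ∑ g², whose numerator over the even power D^(2n+2) is a sum of squares.
      have hdiff : paramHom a d e (p - ∑ i, g i ^ 2) *
          algebraMap ℝ[X] (RatFunc ℝ) (denPoly d) ^ (2 * (n + 1)) =
            algebraMap _ _ (∑ j, q j ^ 2) := by
        simp only [map_sub, map_sum, map_pow, hp', add_sub_cancel_left, Finset.sum_mul, ← hq]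
        exact Finset.sum_congr rfl fun j _ => by ring
      have hev := evalAt_curvePoint_mul_den_pow hz hdiff
      rw [← hzeq, eval_finsetSum, map_sub] at hev
      have h3 : 0 ≤ ∑ j, (q j ^ 2).eval (z.1 1) :=
        Finset.sum_nonneg fun j _ => by rw [eval_pow]; positivity
      have h4 : 0 < (z.1 1 ^ 2 - d) ^ (2 * (n + 1)) :=
        (even_two_mul _).pow_pos (sub_ne_zero.2 hz)
      rw [← hev] at h3
      have h5 := nonneg_of_mul_nonneg_left h3 h4
      have h6 := evalAt_nonneg_of_eq_sum_sq z g
      linarith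

end RationalCubic

theorem theorem4p3 (a d e : ℝ) (hP : Irreducible (RationalCubic.cubic a d e)) :
    (∀ (k : ℕ) (p : RatFunc ℝ), p ∈ RationalCubic.PosS a d e (2 * k) →
      ∃ (m n : ℕ) (f : Fin m → RatFunc ℝ) (g : Fin n → RatFunc ℝ),
        (∀ i, f i ∈ RationalCubic.S a d e k) ∧ (∀ j, g j ∈ RationalCubic.T a d e k) ∧
        p = ∑ i, (f i) ^ 2 + ∑ j, (g j) ^ 2) ∧
    RationalCubic.IsCertificatePair (RationalCubic.curve a d e) 1 (RationalCubic.V a d e) ∧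
    (∀ k : ℕ, 1 ≤ k →
      LinearIndepOn ℝ id (RationalCubic.basisB a d e k) ∧
      Submodule.span ℝ (RationalCubic.basisB a d e k) =
        RationalCubic.coordDegLE (RationalCubic.curve a d e) k ∧
      LinearIndepOn ℝ id (RationalCubic.basisV a d e k)) := by
  have hco := RationalCubic.isCoprime_of_irreducible_cubic hP
  refine ⟨fun k p hp => ?_, RationalCubic.isCertificatePair hco, fun k hk => ?_⟩
  · rcases k with _ | n
    · obtain ⟨f, hf, h⟩ := RationalCubic.exists_sq_of_mem_PosS_zero hp
      exact ⟨1, 0, fun _ => f, Fin.elim0, fun _ => hf, fun j => j.elim0, by simpa using h⟩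
    · obtain ⟨f, hf, g, hg, h⟩ := RationalCubic.exists_sq_add_sq_of_mem_PosS hco n hp
      exact ⟨1, 1, fun _ => f, fun _ => g, fun _ => hf, fun _ => hg, by simpa using h⟩
  · obtain ⟨n, rfl⟩ : ∃ n, k = n + 1 := ⟨k - 1, by omega⟩
    refine ⟨RationalCubic.linearIndepOn_id_of_image (RationalCubic.paramHom a d e).toLinearMap
      (RationalCubic.paramHom_injective hco) ?_, RationalCubic.span_basisB hco n,
      RationalCubic.linearIndepOn_id_of_image (RationalCubic.fracHom hco).toLinearMap
      (RationalCubic.fracHom_injective hco) ?_⟩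
    · rw [AlgHom.coe_toLinearMap, RationalCubic.paramHom_image_basisB]
      exact RationalCubic.linearIndepOn_basisS hco n
    · rw [AlgHom.coe_toLinearMap, RationalCubic.fracHom_image_basisV]
      exact RationalCubic.linearIndepOn_basisT hco n
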